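/- **Theorem.** Let $d\in\mathbb N$, $\phi\in(0,1)$ (precision of the rank) and $M>1$ (the default is $M=2$). For a data set $D=\{(x_i,y_i)\}_{i=1}^n\subset\mathbb R^d\times\mathbb R$, a number $T>0$ and $s=0,1,2,\dots$, let $\epsilon_s=T/M^s$, let $G_s$ be the Gaussian kernel matrix with entries $(G_s)_{ij}=\exp(-\|x_i-x_j\|^2/\epsilon_s)$, and let its numerical rank be $\#\{0\le j<n:\ \sigma_j(G_s)/\sigma_0(G_s)\ge\phi\}$, where $\sigma_0(G_s)\ge\sigma_1(G_s)\ge\dots\ge\sigma_{n-1}(G_s)$ are the singular values of $G_s$. The scale loop of the main algorithm starts with $s=0$, $l=0$ and, while $l<n$, forms $G_s$, sets $l$ to the numerical rank of $G_s$, carries out further instructions (random sketching, pivoted QR, model fitting and comparison of the fitting costs) that change neither $s$, $l$ nor the data, and increases $s$ by $1$. 1. (Finiteness.) For every $n$, every data set of size $n$ whose input points $x_1,\dots,x_n$ are pairwise distinct, and every $T>0$, the loop terminates after finitely many iterations. 2. (Logarithmic growth.) Let the data be independent samples $(x_1,y_1),(x_2,y_2),\dots$ from a fixed probability distribution $p$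 on $\mathbb R^d\times\mathbb R$ such that (a) there are $\alpha>0$ and $C$ such that two independent draws $(x,y),(x',y')$ from $p$ satisfy $\Pr(\|x-x'\|\le r)\le C r^{\alpha}$ for all $r>0$ (for example, with $d\ge 1$ and $\alpha=d$, if $x$ has a bounded density), and (b) $\mathbb E\|x\|^\beta<\infty$ for some $\beta>0$ (for example, if $x$ takes values in a bounded set). Let either $T>0$ be fixed, or let $T=2(\operatorname{diam}\{x_1,\dots,x_n\}/2)^2$ be computed from the first $n$ samples. Then there is a constant $K$, depending only on $d,\phi,M,p$ and the rule for $T$, such that almost surely the loop, run on the first $n$ samples, terminates for every $n\ge 2$ after a finite number $N_n$ of iterations, and $N_n\le K\log_2 n$ for all sufficiently large $n$; that is, $N_n=O(\log_2 n)$. -/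

import Mathlib

open MeasureTheory ProbabilityTheory Filter

noncomputable section

namespace MultiscaleAlgo

/-- A data set of size `n`: input points `x i ∈ ℝ^d` with observed values `y i ∈ ℝ`,
stored as `D i = (x i, y i)`. -/
abbrev Dataset (d n : ℕ) : Type := Fin n → EuclideanSpace ℝ (Fin d) × ℝ

/-- The default choice `T = 2 (Diameter(X) / 2) ^ 2`, where the diameter of the data is the largest
distance between two input points. -/
def defaultT {d n : ℕ} (D : Dataset d n) : ℝ :=
  2 * (Metric.diam (Set.range fun i => (D i).1) / 2) ^ 2

/-- The length scale `ε_s = T / M ^ s`. -/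
def lengthScale (T M : ℝ) (s : ℕ) : ℝ := T / M ^ s

/-- The Gaussian kernel matrix with entries `exp (-‖x_i - x_j‖ ^ 2 / ε)`. -/
def gaussianKernel {d n : ℕ} (D : Dataset d n) (ε : ℝ) : Matrix (Fin n) (Fin n) ℝ :=
  Matrix.of fun i j => Real.exp (-(‖(D i).1 - (D j).1‖ ^ 2 / ε))

/-- The singular values `σ_0 ≥ σ_1 ≥ ... ≥ σ_{n-1}` of a square matrix, with multiplicity. -/
def singularValue {n : ℕ} (G : Matrix (Fin n) (Fin n) ℝ) (j : ℕ) : ℝ :=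
  (Matrix.toEuclideanLin G).singularValues j

/-- The numerical rank with precision `φ`: the number of indices `0 ≤ j < n` such that
`σ_j / σ_0 ≥ φ`. -/
def numericalRank {n : ℕ} (φ : ℝ) (G : Matrix (Fin n) (Fin n) ℝ) : ℕ :=
  ((Finset.range n).filter fun j => φ ≤ singularValue G j / singularValue G 0).card

/-- The variables of the main algorithm: the scale `s`, the numerical rank `l_s`, and the contents
`mem` of all other variables (threshold `T_h`, sparse sets, bases, permutations, weights,
hyperparameters, best model found so far, ...). -/
structure State (σ : Type) where
  scale : ℕ
  rank : ℕ
  mem : σ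

/-- The loop guard `l_s < n`. -/
def guard {σ : Type} (n : ℕ) (a : State σ) : Prop := a.rank < n

/-- One pass through the loop body: form `G_s` with `ε_s = T / M ^ s`, set `l_s` to the numerical
rank of `G_s`, carry out the other instructions, and increase `s`. The other instructions
(random sketch, pivoted QR, model fitting, comparison of the costs, ...) write neither `s` nor
`l_s`; they are an arbitrary update `body s l_s` of the remaining memory. -/
def step {σ : Type} {d n : ℕ} (φ T M : ℝ) (D : Dataset d n) (body : ℕ → ℕ → σ → σ)
    (a : State σ) : State σ :=
  let l := numericalRank φ (gaussianKernel D (lengthScale T M a.scale))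
  { scale := a.scale + 1, rank := l, mem := body a.scale l a.mem }

/-- `WhileRuns test f a k b`: started in state `a`, the loop `while test do f` terminates after
exactly `k` iterations, in state `b`. -/
inductive WhileRuns {α : Type} (test : α → Prop) (f : α → α) : α → ℕ → α → Prop
  | done (a : α) : ¬ test a → WhileRuns test f a 0 a
  | next (a : α) (k : ℕ) (b : α) : test a → WhileRuns test f (f a) k b →
      WhileRuns test f a (k + 1) b

/-- On the data set `D`, the `while` loop of the main algorithm, started at `s = 0`, `l = 0`,
terminates after exactly `k` iterations, whatever the remaining instructions of the loop body do
and whatever the initial contents `m` of the other variables are. -/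
def TerminatesAfter {d n : ℕ} (φ T M : ℝ) (D : Dataset d n) (k : ℕ) : Prop :=
  ∀ (σ : Type) (body : ℕ → ℕ → σ → σ) (m : σ),
    ∃ b : State σ, WhileRuns (guard n) (step φ T M D body) ⟨0, 0, m⟩ k b

end MultiscaleAlgo

end

namespace MultiscaleAlgo

/-! If distinct points are at distance at least `r`, the kernel matrix at length scale `ε` differs
from the identity by at most `exp (-r²/ε)` per entry, so all its singular values lie within `n * exp
(-r²/ε)` of `1`. Once this error is at most `(1 - φ) / (1 + φ)`, the numerical rank is `n` and the
loop stops (`numericalRank_gaussianKernel_eq`, `exists_terminatesAfter_le`). Since `ε_s` decays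
geometrically, this happens for every fixed separation.

For random samples, a union bound over pairs, Markov's inequality and Borel–Cantelli show that
almost surely, for large `n`, the separation is at least a negative power of `n` and the norms are
at most a power of `n`. Both rules for `T` are then polynomially bounded, and `M ^ s` overtakes any
power of `n` after `O(log n)` scales (`exists_log_scale`). -/

/-! ### Kernel matrices close to the identity. -/

/-- Every singular value with index below the dimension is the stretching factor of some nonzero
vector. -/
theorem exists_norm_map_eq_singularValue {E F : Type*} [NormedAddCommGroup E]
    [InnerProductSpace ℝ E] [FiniteDimensional ℝ E] [NormedAddCommGroup F]
    [InnerProductSpace ℝ F] [FiniteDimensional ℝ F] (A : E →ₗ[ℝ] F) {j : ℕ}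
    (hj : j < Module.finrank ℝ E) :
    ∃ v : E, v ≠ 0 ∧ ‖A v‖ = A.singularValues j * ‖v‖ := by
  obtain ⟨v, hv⟩ := (A.hasEigenvalue_adjoint_comp_self_sq_singularValues hj).exists_hasEigenvector
  refine ⟨v, hv.2, ?_⟩
  have h1 := hv.apply_eq_smul
  have h2 : ‖A v‖ ^ 2 = (A.singularValues j * ‖v‖) ^ 2 := by
    rw [← real_inner_self_eq_norm_sq, ← LinearMap.adjoint_inner_left]
    rw [LinearMap.comp_apply] at h1
    rw [h1, RCLike.ofReal_real_eq_id, id, real_inner_smul_left, real_inner_self_eq_norm_sq]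
    ring
  have h3 : 0 ≤ A.singularValues j * ‖v‖ :=
    mul_nonneg (A.singularValues_nonneg j) (norm_nonneg v)
  exact (sq_eq_sq₀ (norm_nonneg _) h3).mp h2

/-- A matrix whose entries are within `δ` of those of the identity matrix is close to the identity
in operator norm. -/
theorem norm_toEuclideanLin_sub_self_le {n : ℕ} {G : Matrix (Fin n) (Fin n) ℝ} {δ : ℝ}
    (hδ : 0 ≤ δ) (hG : ∀ i j, |G i j - (1 : Matrix (Fin n) (Fin n) ℝ) i j| ≤ δ)
    (x : EuclideanSpace ℝ (Fin n)) :
    ‖Matrix.toEuclideanLin G x - x‖ ≤ n * δ * ‖x‖ := by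
  refine le_of_sq_le_sq ?_ (by positivity)
  have hcoord : ∀ i, (Matrix.toEuclideanLin G x - x) i =
      ∑ j, (G - 1) i j * x j := by
    intro i
    have h1 : x i = ((1 : Matrix (Fin n) (Fin n) ℝ).mulVec x) i := by rw [Matrix.one_mulVec]
    rw [PiLp.sub_apply, h1]
    simp [Matrix.mulVec, dotProduct, Matrix.sub_apply, sub_mul, Finset.sum_sub_distrib]
  rw [EuclideanSpace.norm_sq_eq]
  calc ∑ i, ‖(Matrix.toEuclideanLin G x - x) i‖ ^ 2
      ≤ ∑ _i : Fin n, (n * δ ^ 2) * ‖x‖ ^ 2 := by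
        refine Finset.sum_le_sum fun i _ => ?_
        rw [hcoord, Real.norm_eq_abs, sq_abs]
        -- Cauchy–Schwarz in each row.
        refine (Finset.sum_mul_sq_le_sq_mul_sq _ _ _).trans ?_
        have h1 : ∑ j, (G - 1) i j ^ 2 ≤ n * δ ^ 2 := by
          calc ∑ j, (G - 1) i j ^ 2 ≤ ∑ _j : Fin n, δ ^ 2 :=
                Finset.sum_le_sum fun j _ => sq_le_sq' (neg_le_of_abs_le (hG i j))
                  (le_of_abs_le (hG i j))
            _ = n * δ ^ 2 := by simp
        have h2 : ∑ j, x j ^ 2 = ‖x‖ ^ 2 := by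
          rw [EuclideanSpace.norm_sq_eq]; simp
        rw [h2]
        gcongr
    _ = (n * δ * ‖x‖) ^ 2 := by simp; ring

/-- A matrix sufficiently close to the identity matrix has full numerical rank. -/
theorem numericalRank_eq_of_near_one {n : ℕ} {φ δ : ℝ} (hφ : 0 < φ) (hφ₁ : φ < 1)
    {G : Matrix (Fin n) (Fin n) ℝ} (hδ : 0 ≤ δ)
    (hG : ∀ i j, |G i j - (1 : Matrix (Fin n) (Fin n) ℝ) i j| ≤ δ)
    (hn : n * δ ≤ (1 - φ) / (1 + φ)) : numericalRank φ G = n := by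
  have hbound : ∀ j < n, |singularValue G j - 1| ≤ n * δ := by
    intro j hj
    obtain ⟨v, hv, hGv⟩ := exists_norm_map_eq_singularValue (Matrix.toEuclideanLin G) (j := j)
      (by simpa using hj)
    have h1 := norm_toEuclideanLin_sub_self_le hδ hG v
    have h2 := abs_norm_sub_norm_le (Matrix.toEuclideanLin G v) v
    have hv' : 0 < ‖v‖ := norm_pos_iff.mpr hv
    have h3 : |singularValue G j - 1| * ‖v‖ ≤ n * δ * ‖v‖ := by
      calc |singularValue G j - 1| * ‖v‖ = |‖Matrix.toEuclideanLin G v‖ - ‖v‖| := by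
            rw [hGv, ← abs_of_pos hv', ← abs_mul, abs_of_pos hv', sub_mul, one_mul, singularValue]
        _ ≤ n * δ * ‖v‖ := h2.trans h1
    exact le_of_mul_le_mul_right h3 hv'
  -- With all singular values in `[1 - nδ, 1 + nδ]`, each ratio is at least `(1 - nδ) / (1 + nδ)`;
  -- this is at least `φ` exactly under the bound `hn`.
  have hn' : n * δ * (1 + φ) ≤ 1 - φ := (le_div_iff₀ (by linarith)).mp hn
  have hnδ : 0 ≤ n * δ := by positivity
  rw [numericalRank, Finset.filter_true_of_mem, Finset.card_range]
  intro j hj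
  have hj' := Finset.mem_range.mp hj
  have hσ := abs_le.mp (hbound j hj')
  have hσ₀ := abs_le.mp (hbound 0 (by omega))
  have hpos : 0 < singularValue G 0 := by nlinarith
  rw [le_div_iff₀ hpos]
  nlinarith

/-- The Gaussian kernel matrix has full numerical rank once the separation of the points is large
compared with the length scale. -/
theorem numericalRank_gaussianKernel_eq {d n : ℕ} {φ ε r : ℝ} (hφ : 0 < φ) (hφ₁ : φ < 1)
    (D : Dataset d n) (hε : 0 < ε) (hr : 0 ≤ r)
    (hD : ∀ i j, i ≠ j → r ≤ dist (D i).1 (D j).1)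
    (hn : n * Real.exp (-(r ^ 2 / ε)) ≤ (1 - φ) / (1 + φ)) :
    numericalRank φ (gaussianKernel D ε) = n := by
  refine numericalRank_eq_of_near_one hφ hφ₁ (Real.exp_pos _).le (fun i j => ?_) hn
  rcases eq_or_ne i j with rfl | hij
  · simp [gaussianKernel, Real.exp_nonneg]
  · rw [Matrix.one_apply_ne hij, sub_zero, gaussianKernel, Matrix.of_apply,
      abs_of_pos (Real.exp_pos _), ← dist_eq_norm]
    have := hD i j hij
    gcongr

/-! ### Termination of the loop. -/

/-- Here `k` counts the scales left before the first full-rank scale `s`. The pass at `s` itself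
still runs, because the guard sees a rank only after the pass computing it; hence `k + 1`. -/
theorem whileRuns_of_rank_lt {σ : Type} {d n : ℕ} {φ T M : ℝ} {D : Dataset d n}
    {body : ℕ → ℕ → σ → σ} {s : ℕ}
    (hs : n ≤ numericalRank φ (gaussianKernel D (lengthScale T M s)))
    (hmin : ∀ t < s, numericalRank φ (gaussianKernel D (lengthScale T M t)) < n) (k : ℕ) :
    ∀ a : State σ, a.rank < n → a.scale + k = s →
      ∃ b, WhileRuns (guard n) (step φ T M D body) a (k + 1) b := by
  induction k with
  | zero =>
    intro a ha has
    obtain rfl : a.scale = s := has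
    exact ⟨_, .next _ _ _ ha (.done _ (not_lt.mpr hs))⟩
  | succ k ih =>
    intro a ha has
    obtain ⟨b, hb⟩ := ih (step φ T M D body a) (hmin _ (by omega))
      (by change a.scale + 1 + k = s; omega)
    exact ⟨b, .next _ _ _ ha hb⟩

/-- If the numerical rank is full at scale `s`, the loop stops after at most `s + 1` iterations. -/
theorem exists_terminatesAfter_le {d n : ℕ} {φ T M : ℝ} {D : Dataset d n} {s : ℕ}
    (hs : numericalRank φ (gaussianKernel D (lengthScale T M s)) = n) :
    ∃ k ≤ s + 1, TerminatesAfter φ T M D k := by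
  rcases Nat.eq_zero_or_pos n with rfl | hn
  · exact ⟨0, by omega, fun σ body m => ⟨_, .done _ (Nat.not_lt_zero _)⟩⟩
  · classical
    have hex : ∃ s, n ≤ numericalRank φ (gaussianKernel D (lengthScale T M s)) := ⟨s, hs.ge⟩
    refine ⟨Nat.find hex + 1, Nat.succ_le_succ (Nat.find_min' hex hs.ge), fun σ body m => ?_⟩
    exact whileRuns_of_rank_lt (Nat.find_spec hex)
      (fun t ht => not_le.mp (Nat.find_min hex ht)) _ _ hn (Nat.zero_add _)

theorem exists_separation {d n : ℕ} (D : Dataset d n)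
    (hD : Function.Injective fun i => (D i).1) :
    ∃ r : ℝ, 0 < r ∧ ∀ i j, i ≠ j → r ≤ dist (D i).1 (D j).1 := by
  -- Taking `r` small also covers `n ≤ 1`, where there are no pairs to minimise over.
  have h : ∀ᶠ r : ℝ in nhdsWithin 0 (Set.Ioi 0),
      ∀ i j, i ≠ j → r ≤ dist (D i).1 (D j).1 := by
    simp only [eventually_all]
    exact fun i j hij => nhdsWithin_le_nhds (eventually_le_nhds (dist_pos.mpr (hD.ne hij)))
  obtain ⟨r, hr, h⟩ := (eventually_mem_nhdsWithin.and h).exists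
  exact ⟨r, hr, h⟩

theorem exists_terminatesAfter {d n : ℕ} {φ T M : ℝ} (hφ : 0 < φ) (hφ₁ : φ < 1) (hM : 1 < M)
    (D : Dataset d n) (hD : Function.Injective fun i => (D i).1) (hT : 0 < T) :
    ∃ k, TerminatesAfter φ T M D k := by
  obtain ⟨r, hr, hsep⟩ := exists_separation D hD
  have hlim : Tendsto (fun s : ℕ => n * Real.exp (-(r ^ 2 / lengthScale T M s))) atTop
      (nhds (n * 0)) := by
    refine Tendsto.const_mul _ (Real.tendsto_exp_neg_atTop_nhds_zero.comp ?_)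
    have h : (fun s : ℕ => r ^ 2 / lengthScale T M s) = fun s => r ^ 2 / T * M ^ s := by
      funext s
      rw [lengthScale]
      field_simp
    rw [h]
    exact (tendsto_pow_atTop_atTop_of_one_lt hM).const_mul_atTop (by positivity)
  rw [mul_zero] at hlim
  have hc : 0 < (1 - φ) / (1 + φ) := div_pos (by linarith) (by linarith)
  obtain ⟨s, hs⟩ := (hlim.eventually_le_const hc).exists
  have hε : 0 < lengthScale T M s := div_pos hT (pow_pos (by linarith) s)
  obtain ⟨k, -, hk⟩ := exists_terminatesAfter_le
    (numericalRank_gaussianKernel_eq hφ hφ₁ D hε hr.le hsep hs)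
  exact ⟨k, hk⟩

/-! ### Counting scales. -/

/-- Logarithmically many scales suffice when the separation of the points decays at most
polynomially and `T` grows at most polynomially. -/
theorem exists_log_scale {c M A B γ : ℝ} (hc : 0 < c) (hM : 1 < M) (hA : 0 < A) (hB : 0 ≤ B)
    (hγ : 0 < γ) :
    ∃ K : ℝ, ∀ᶠ n : ℕ in atTop, ∃ s : ℕ, ((s + 1 : ℕ) : ℝ) ≤ K * Real.logb 2 n ∧
      ∀ T, 0 < T → T ≤ A * (n : ℝ) ^ B →
        n * Real.exp (-(((n : ℝ) ^ (-γ)) ^ 2 / lengthScale T M s)) ≤ c := by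
  -- If `M ^ s ≥ n ^ Q`, the exponent is at least `n ^ (-2γ + Q - B) / A = n² / A`, which exceeds `n
  -- / c` once `n ≥ A / c`.
  obtain ⟨Q, hQ⟩ : ∃ Q, Q = 2 * γ + B + 2 := ⟨_, rfl⟩
  have hQ0 : 0 < Q := by linarith
  have hM0 : 0 < M := by linarith
  have hlogM : 0 < Real.log M := Real.log_pos hM
  -- The `2` absorbs the ceiling and the extra iteration, as `logb 2 n ≥ 1`.
  refine ⟨Q * Real.log 2 / Real.log M + 2, ?_⟩
  filter_upwards [eventually_ge_atTop 2, eventually_ge_atTop ⌈A / c⌉₊] with n hn2 hnA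
  have hn2' : (2 : ℝ) ≤ n := by exact_mod_cast hn2
  have hn0 : (0 : ℝ) < n := by linarith
  have hlogn : 0 < Real.log n := Real.log_pos (by linarith)
  have hnA' : A / c ≤ n := (Nat.le_ceil _).trans (by exact_mod_cast hnA)
  have hx : 0 ≤ Q * Real.log n / Real.log M := by positivity
  refine ⟨⌈Q * Real.log n / Real.log M⌉₊, ?_, ?_⟩
  · have h1 := (Nat.ceil_lt_add_one hx).le
    have hlog2 : 0 < Real.log 2 := Real.log_pos one_lt_two
    have h2 : 1 ≤ Real.logb 2 n := by
      rw [Real.le_logb_iff_rpow_le one_lt_two hn0]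
      simpa using hn2'
    have h3 : Q * Real.log 2 / Real.log M * Real.logb 2 n = Q * Real.log n / Real.log M := by
      rw [Real.logb]
      field_simp
    rw [add_mul, h3, Nat.cast_succ]
    linarith
  · intro T hT hTn
    set s := ⌈Q * Real.log n / Real.log M⌉₊
    have hMs : (n : ℝ) ^ Q ≤ M ^ s := by
      rw [← Real.log_le_log_iff (by positivity) (by positivity), Real.log_rpow hn0, Real.log_pow]
      exact (div_le_iff₀ hlogM).mp (Nat.le_ceil _)
    have hexp : n / c ≤ ((n : ℝ) ^ (-γ)) ^ 2 / lengthScale T M s := by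
      have hAn : n / c ≤ (n : ℝ) ^ 2 / A := by
        rw [div_le_iff₀ hc] at hnA'
        rw [div_le_div_iff₀ hc hA]
        nlinarith
      refine hAn.trans ?_
      have hpow : ((n : ℝ) ^ (-γ)) ^ 2 * (n : ℝ) ^ Q = (n : ℝ) ^ 2 * (n : ℝ) ^ B := by
        rw [← Real.rpow_natCast ((n : ℝ) ^ (-γ)), ← Real.rpow_mul hn0.le, ← Real.rpow_natCast,
          ← Real.rpow_add hn0, ← Real.rpow_add hn0, hQ]
        congr 1
        push_cast
        ring
      calc (n : ℝ) ^ 2 / A = ((n : ℝ) ^ (-γ)) ^ 2 * (n : ℝ) ^ Q / (A * (n : ℝ) ^ B) := by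
            rw [hpow]
            field_simp
        _ ≤ ((n : ℝ) ^ (-γ)) ^ 2 * M ^ s / T := by gcongr
        _ = ((n : ℝ) ^ (-γ)) ^ 2 / lengthScale T M s := by
            rw [lengthScale]
            field_simp
    have hy : 0 < n / c := div_pos hn0 hc
    calc n * Real.exp (-(((n : ℝ) ^ (-γ)) ^ 2 / lengthScale T M s))
        ≤ n * Real.exp (-(n / c)) := by gcongr
      _ ≤ n * (n / c)⁻¹ := by
          rw [Real.exp_neg]
          gcongr
          linarith [Real.add_one_le_exp (n / c)]
      _ = c := by field_simp

theorem defaultT_pos {d n : ℕ} (hn : 2 ≤ n) (D : Dataset d n)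
    (hD : Function.Injective fun i => (D i).1) : 0 < defaultT D := by
  have hne : (D ⟨0, by omega⟩).1 ≠ (D ⟨1, by omega⟩).1 := fun h => by
    simpa using hD h
  have h := Metric.dist_le_diam_of_mem (Set.finite_range fun i => (D i).1).isBounded
    (Set.mem_range_self (⟨0, by omega⟩ : Fin n)) (Set.mem_range_self (⟨1, by omega⟩ : Fin n))
  have := (dist_pos.mpr hne).trans_le h
  unfold defaultT
  positivity

theorem defaultT_le {d n : ℕ} (D : Dataset d n) {R : ℝ} (hR : 0 ≤ R)
    (hD : ∀ i, ‖(D i).1‖ ≤ R) : defaultT D ≤ 2 * R ^ 2 := by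
  have h : Metric.diam (Set.range fun i => (D i).1) ≤ 2 * R := by
    refine Metric.diam_le_of_forall_dist_le (by positivity) ?_
    rintro _ ⟨i, rfl⟩ _ ⟨j, rfl⟩
    linarith [dist_le_norm_add_norm (D i).1 (D j).1, hD i, hD j]
  have h0 : 0 ≤ Metric.diam (Set.range fun i => (D i).1) := Metric.diam_nonneg
  unfold defaultT
  gcongr
  linarith

/-! ### Almost sure estimates for independent samples. -/

section Samples

variable {d : ℕ} {p : Measure (EuclideanSpace ℝ (Fin d) × ℝ)}
  {Ω : Type*} [MeasurableSpace Ω] {P : Measure Ω}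
  {Z : ℕ → Ω → EuclideanSpace ℝ (Fin d) × ℝ}

theorem measure_dist_le [IsProbabilityMeasure P] (hZ : ∀ i, Measurable (Z i)) (hind : iIndepFun Z P)
    (hlaw : ∀ i, P.map (Z i) = p) {i j : ℕ} (hij : i ≠ j) (r : ℝ) :
    P {ω | dist (Z i ω).1 (Z j ω).1 ≤ r} = (p.prod p) {z | dist z.1.1 z.2.1 ≤ r} := by
  have h := (indepFun_iff_map_prod_eq_prod_map_map (hZ i).aemeasurable
    (hZ j).aemeasurable).mp (hind.indepFun hij)
  rw [hlaw, hlaw] at h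
  rw [← h, Measure.map_apply ((hZ i).prodMk (hZ j))]
  · rfl
  · exact measurableSet_le (by fun_prop) measurable_const

/-- A coincidence lies in every event `dist ≤ r`, so its probability is at most `C * r ^ α` for all
`r > 0`; let `r → 0`. -/
theorem ae_injective [IsProbabilityMeasure P] (hZ : ∀ i, Measurable (Z i)) (hind : iIndepFun Z P)
    (hlaw : ∀ i, P.map (Z i) = p) {α C : ℝ} (hα : 0 < α)
    (hC : ∀ r : ℝ, 0 < r →
      (p.prod p) {z | dist z.1.1 z.2.1 ≤ r} ≤ ENNReal.ofReal (C * r ^ α)) :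
    ∀ᵐ ω ∂P, Function.Injective fun i => (Z i ω).1 := by
  have hpair : ∀ i j, i ≠ j → ∀ᵐ ω ∂P, (Z i ω).1 ≠ (Z j ω).1 := by
    intro i j hij
    rw [ae_iff]
    have hlim : Tendsto (fun r : ℝ => ENNReal.ofReal (C * r ^ α)) (nhdsWithin 0 (Set.Ioi 0))
        (nhds 0) := by
      have h : Tendsto (fun r : ℝ => C * r ^ α) (nhds 0) (nhds (C * 0 ^ α)) :=
        ((Real.continuous_rpow_const hα.le).tendsto 0).const_mul C
      rw [Real.zero_rpow hα.ne', mul_zero] at h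
      simpa using ENNReal.tendsto_ofReal (h.mono_left nhdsWithin_le_nhds)
    refine le_antisymm (ge_of_tendsto hlim ?_) zero_le
    filter_upwards [self_mem_nhdsWithin] with r hr
    refine le_trans (measure_mono fun ω hω => ?_)
      ((measure_dist_le hZ hind hlaw hij r).trans_le (hC r hr))
    have hω' : (Z i ω).1 = (Z j ω).1 := not_not.mp hω
    simpa [hω'] using (Set.mem_Ioi.mp hr).le
  have hall : ∀ᵐ ω ∂P, ∀ i j, i ≠ j → (Z i ω).1 ≠ (Z j ω).1 := by
    rw [ae_all_iff]; intro i
    rw [ae_all_iff]; intro j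
    by_cases hij : i = j
    · simp [hij]
    · filter_upwards [hpair i j hij] with ω h _ using h
  filter_upwards [hall] with ω h i j hij
  by_contra hne
  exact h i j hne hij

theorem summable_div_sq (C : ℝ) : Summable fun n : ℕ => C * ((n : ℝ) ^ 2)⁻¹ :=
  (Real.summable_nat_pow_inv.mpr one_lt_two).mul_left C

/-- Almost surely, the separation of the first `n` samples decays at most polynomially. -/
theorem ae_eventually_separated [IsProbabilityMeasure P] (hZ : ∀ i, Measurable (Z i)) (hind : iIndepFun Z P)
    (hlaw : ∀ i, P.map (Z i) = p) {α C : ℝ} (hα : 0 < α)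
    (hC : ∀ r : ℝ, 0 < r →
      (p.prod p) {z | dist z.1.1 z.2.1 ≤ r} ≤ ENNReal.ofReal (C * r ^ α)) :
    ∀ᵐ ω ∂P, ∀ᶠ n : ℕ in atTop, ∀ i < n, ∀ j < n, i ≠ j →
      (n : ℝ) ^ (-(4 / α)) ≤ dist (Z i ω).1 (Z j ω).1 := by
  set bad : ℕ → Set Ω := fun n => ⋃ q ∈ (Finset.range n ×ˢ Finset.range n).filter
    (fun q => q.1 ≠ q.2), {ω | dist (Z q.1 ω).1 (Z q.2 ω).1 ≤ (n : ℝ) ^ (-(4 / α))} with hbad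
  have hmeas : ∀ n, P (bad n) ≤ ENNReal.ofReal (C * ((n : ℝ) ^ 2)⁻¹) := by
    intro n
    rcases Nat.eq_zero_or_pos n with rfl | hn
    · simp [hbad]
    have hn0 : (0 : ℝ) < n := by exact_mod_cast hn
    -- The exponent `4 / α` gives each pair probability `O(n⁻⁴)`; at most `n²` pairs leave a
    -- summable `O(n⁻²)`.
    have hr : (((n : ℝ) ^ (-(4 / α))) ^ α) = ((n : ℝ) ^ 4)⁻¹ := by
      rw [← Real.rpow_mul hn0.le, neg_mul, div_mul_cancel₀ _ hα.ne', Real.rpow_neg hn0.le]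
      norm_cast
    calc P (bad n) ≤ ∑ q ∈ (Finset.range n ×ˢ Finset.range n).filter (fun q => q.1 ≠ q.2),
          P {ω | dist (Z q.1 ω).1 (Z q.2 ω).1 ≤ (n : ℝ) ^ (-(4 / α))} :=
          measure_biUnion_finset_le _ _
      _ ≤ ∑ _q ∈ (Finset.range n ×ˢ Finset.range n).filter (fun q => q.1 ≠ q.2),
          ENNReal.ofReal (C * ((n : ℝ) ^ 4)⁻¹) := by
          refine Finset.sum_le_sum fun q hq => ?_
          rw [measure_dist_le hZ hind hlaw (Finset.mem_filter.mp hq).2, ← hr]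
          exact hC _ (by positivity)
      _ ≤ ∑ _q ∈ Finset.range n ×ˢ Finset.range n, ENNReal.ofReal (C * ((n : ℝ) ^ 4)⁻¹) :=
          Finset.sum_le_sum_of_subset (Finset.filter_subset _ _)
      _ = ENNReal.ofReal (C * ((n : ℝ) ^ 2)⁻¹) := by
          rw [Finset.sum_const, Finset.card_product, Finset.card_range, nsmul_eq_mul,
            ← ENNReal.ofReal_natCast, ← ENNReal.ofReal_mul (by positivity)]
          congr 1
          push_cast
          field_simp
  have hsum : ∑' n, P (bad n) ≠ ⊤ :=
    ((ENNReal.tsum_le_tsum hmeas).trans_lt (summable_div_sq C).tsum_ofReal_lt_top).ne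
  filter_upwards [ae_eventually_notMem hsum] with ω hω
  filter_upwards [hω] with n hn i hi j hj hij
  by_contra! hlt
  refine hn (Set.mem_biUnion (x := (i, j)) ?_ hlt.le)
  simp [hi, hj, hij]

/-- Almost surely, the first `n` samples are bounded by a power of `n`. -/
theorem ae_eventually_norm_le [IsProbabilityMeasure p] (hZ : ∀ i, Measurable (Z i))
    (hlaw : ∀ i, P.map (Z i) = p) {β : ℝ} (hβ : 0 < β)
    (hint : Integrable (fun z => ‖z.1‖ ^ β) p) :
    ∀ᵐ ω ∂P, ∀ᶠ n : ℕ in atTop, ∀ i < n, ‖(Z i ω).1‖ ≤ (n : ℝ) ^ (3 / β) := by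
  set I := ∫ z, ‖z.1‖ ^ β ∂p
  set bad : ℕ → Set Ω := fun n => ⋃ i ∈ Finset.range n,
    {ω | (n : ℝ) ^ (3 / β) ≤ ‖(Z i ω).1‖} with hbad
  have hmeas : ∀ n, P (bad n) ≤ ENNReal.ofReal (I * ((n : ℝ) ^ 2)⁻¹) := by
    intro n
    rcases Nat.eq_zero_or_pos n with rfl | hn
    · simp [hbad]
    have hn0 : (0 : ℝ) < n := by exact_mod_cast hn
    -- Markov gives `O(n⁻³)` per sample, hence again `O(n⁻²)` in total.
    have hR : ((n : ℝ) ^ (3 / β)) ^ β = (n : ℝ) ^ 3 := by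
      rw [← Real.rpow_mul hn0.le, div_mul_cancel₀ _ hβ.ne']
      norm_cast
    have hone : ∀ i, P {ω | (n : ℝ) ^ (3 / β) ≤ ‖(Z i ω).1‖} ≤
        ENNReal.ofReal (I * ((n : ℝ) ^ 3)⁻¹) := by
      intro i
      have hset : MeasurableSet {z : EuclideanSpace ℝ (Fin d) × ℝ |
          (n : ℝ) ^ (3 / β) ≤ ‖z.1‖} := measurableSet_le measurable_const (by fun_prop)
      have hpush : P {ω | (n : ℝ) ^ (3 / β) ≤ ‖(Z i ω).1‖} =
          p {z | (n : ℝ) ^ (3 / β) ≤ ‖z.1‖} := by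
        rw [← hlaw i, Measure.map_apply (hZ i) hset]
        rfl
      have hmarkov := mul_meas_ge_le_integral_of_nonneg
        (ae_of_all p fun z : EuclideanSpace ℝ (Fin d) × ℝ => Real.rpow_nonneg (norm_nonneg z.1) β)
        hint ((n : ℝ) ^ 3)
      rw [hpush, ← ofReal_measureReal, ← div_eq_mul_inv]
      refine ENNReal.ofReal_le_ofReal ?_
      rw [le_div_iff₀' (by positivity)]
      refine le_trans ?_ hmarkov
      refine mul_le_mul_of_nonneg_left ?_ (by positivity)
      refine measureReal_mono (fun z hz => ?_) (measure_ne_top p _)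
      rw [Set.mem_ofPred_eq] at hz ⊢
      rw [← hR]
      gcongr
    calc P (bad n) ≤ ∑ i ∈ Finset.range n, P {ω | (n : ℝ) ^ (3 / β) ≤ ‖(Z i ω).1‖} :=
          measure_biUnion_finset_le _ _
      _ ≤ ∑ _i ∈ Finset.range n, ENNReal.ofReal (I * ((n : ℝ) ^ 3)⁻¹) :=
          Finset.sum_le_sum fun i _ => hone i
      _ = ENNReal.ofReal (I * ((n : ℝ) ^ 2)⁻¹) := by
          rw [Finset.sum_const, Finset.card_range, nsmul_eq_mul,
            ← ENNReal.ofReal_natCast, ← ENNReal.ofReal_mul (by positivity)]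
          congr 1
          field_simp
  have hsum : ∑' n, P (bad n) ≠ ⊤ :=
    ((ENNReal.tsum_le_tsum hmeas).trans_lt (summable_div_sq I).tsum_ofReal_lt_top).ne
  filter_upwards [ae_eventually_notMem hsum] with ω hω
  filter_upwards [hω] with n hn i hi
  by_contra! hlt
  exact hn (Set.mem_biUnion (x := i) (by simpa using hi) hlt.le)

end Samples

/-- Both rules for `T` give a positive value on distinct points, polynomially bounded in `n` when
the points are. -/
theorem exists_bound_of_rule {d : ℕ} {β : ℝ} (hβ : 0 < β) {T : (n : ℕ) → Dataset d n → ℝ}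
    (hT : (∃ T₀ : ℝ, 0 < T₀ ∧ ∀ n D, T n D = T₀) ∨ (∀ n D, T n D = defaultT D)) :
    (∀ n D, 2 ≤ n → (Function.Injective fun i => (D i).1) → 0 < T n D) ∧
    ∃ A B : ℝ, 0 < A ∧ 0 ≤ B ∧ ∀ (n : ℕ) (D : Dataset d n), (∀ i, ‖(D i).1‖ ≤ (n : ℝ) ^ (3 / β)) →
      T n D ≤ A * (n : ℝ) ^ B := by
  rcases hT with ⟨T₀, hT₀, hT⟩ | hT
  · refine ⟨fun n D _ _ => (hT n D).symm ▸ hT₀, T₀, 0, hT₀, le_rfl, fun n D _ => ?_⟩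
    simp [hT n D]
  · refine ⟨fun n D hn hD => (hT n D).symm ▸ defaultT_pos hn D hD, 2, 3 / β * 2, two_pos,
      by positivity, fun n D hD => ?_⟩
    rw [hT n D, Real.rpow_mul n.cast_nonneg, Real.rpow_two]
    exact defaultT_le D (by positivity) hD

end MultiscaleAlgo

theorem mainTheorem8 (d : ℕ) (φ : ℝ) (hφ₀ : 0 < φ) (hφ₁ : φ < 1) (M : ℝ) (hM : 1 < M) :
    -- the loop terminates on every data set with pairwise distinct input points
    (∀ (n : ℕ) (D : MultiscaleAlgo.Dataset d n), (Function.Injective fun i => (D i).1) →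
      ∀ T : ℝ, 0 < T → ∃ k : ℕ, MultiscaleAlgo.TerminatesAfter φ T M D k) ∧
    -- for `n` independent samples of a fixed data distribution `p`, the number of iterations
    -- is `O(log₂ n)`
    (∀ (p : Measure (EuclideanSpace ℝ (Fin d) × ℝ)) [IsProbabilityMeasure p],
      (∃ α : ℝ, 0 < α ∧ ∃ C : ℝ, ∀ r : ℝ, 0 < r →
        (p.prod p) {z | dist z.1.1 z.2.1 ≤ r} ≤ ENNReal.ofReal (C * r ^ α)) →
      (∃ β : ℝ, 0 < β ∧ Integrable (fun z => ‖z.1‖ ^ β) p) →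
      ∀ T : (n : ℕ) → MultiscaleAlgo.Dataset d n → ℝ,
      ((∃ T₀ : ℝ, 0 < T₀ ∧ ∀ n D, T n D = T₀) ∨
        (∀ n D, T n D = MultiscaleAlgo.defaultT D)) →
      ∃ K : ℝ, ∀ (Ω : Type*) [MeasurableSpace Ω] (P : Measure Ω) [IsProbabilityMeasure P]
        (Z : ℕ → Ω → EuclideanSpace ℝ (Fin d) × ℝ),
        (∀ i, Measurable (Z i)) → iIndepFun Z P → (∀ i, P.map (Z i) = p) →
        ∀ᵐ ω ∂P, ∃ N : ℕ → ℕ,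
          (∀ n : ℕ, 2 ≤ n → MultiscaleAlgo.TerminatesAfter φ
            (T n fun i : Fin n => Z i ω) M (fun i : Fin n => Z i ω) (N n)) ∧
          ∀ᶠ n : ℕ in atTop, (N n : ℝ) ≤ K * Real.logb 2 n) := by
  refine ⟨fun n D hD T hT => MultiscaleAlgo.exists_terminatesAfter hφ₀ hφ₁ hM D hD hT, ?_⟩
  rintro p _ ⟨α, hα, C, hC⟩ ⟨β, hβ, hint⟩ T hT
  obtain ⟨hTpos, A, B, hA, hB, hTle⟩ := MultiscaleAlgo.exists_bound_of_rule hβ hT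
  have hc : 0 < (1 - φ) / (1 + φ) := div_pos (by linarith) (by linarith)
  -- `K` is fixed before the probability space and the samples are introduced.
  obtain ⟨K, hK⟩ := MultiscaleAlgo.exists_log_scale hc hM hA hB (γ := 4 / α) (by positivity)
  refine ⟨K, fun Ω _ P _ Z hZ hind hlaw => ?_⟩
  filter_upwards [MultiscaleAlgo.ae_injective hZ hind hlaw hα hC,
    MultiscaleAlgo.ae_eventually_separated hZ hind hlaw hα hC,
    MultiscaleAlgo.ae_eventually_norm_le hZ hlaw hβ hint] with ω hinj hsep hnorm
  have hD : ∀ n, Function.Injective fun i : Fin n => (Z i ω).1 :=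
    fun n => hinj.comp Fin.val_injective
  have hex : ∀ n, ∃ k, (2 ≤ n → MultiscaleAlgo.TerminatesAfter φ
      (T n fun i : Fin n => Z i ω) M (fun i : Fin n => Z i ω) k) ∧
      ∀ s, 2 ≤ n → MultiscaleAlgo.numericalRank φ (MultiscaleAlgo.gaussianKernel
        (fun i : Fin n => Z i ω) (MultiscaleAlgo.lengthScale (T n fun i : Fin n => Z i ω) M s)) = n
        → k ≤ s + 1 := by
    intro n
    by_cases hn : 2 ≤ n
    · have hk := MultiscaleAlgo.exists_terminatesAfter hφ₀ hφ₁ hM (fun i : Fin n => Z i ω) (hD n)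
        (hTpos n _ hn (hD n))
      classical
      refine ⟨Nat.find hk, fun _ => Nat.find_spec hk, fun s _ hs => ?_⟩
      obtain ⟨k, hks, hk'⟩ := MultiscaleAlgo.exists_terminatesAfter_le hs
      exact (Nat.find_min' hk hk').trans hks
    · exact ⟨0, fun h => absurd h hn, fun _ h => absurd h hn⟩
  choose N hN hNle using hex
  refine ⟨N, hN, ?_⟩
  filter_upwards [hK, hsep, hnorm, eventually_ge_atTop 2] with n hKn hsepn hnormn hn
  obtain ⟨s, hsK, hs⟩ := hKn
  have hT0 := hTpos n (fun i : Fin n => Z i ω) hn (hD n)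
  have hTA := hTle n (fun i : Fin n => Z i ω) fun i => hnormn i i.isLt
  have hrank := MultiscaleAlgo.numericalRank_gaussianKernel_eq hφ₀ hφ₁ (fun i : Fin n => Z i ω)
    (div_pos hT0 (pow_pos (by linarith) s)) (Real.rpow_nonneg n.cast_nonneg _)
    (fun i j hij => hsepn i i.isLt j j.isLt (Fin.val_injective.ne hij)) (hs _ hT0 hTA)
  exact le_trans (by exact_mod_cast hNle n s hn hrank) hsK
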